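/- Let $n\ge 2$ and $d$ be natural numbers. An (axis-aligned, nontrivial) cuboid in $\mathbb{R}^d$ is a set $[a_1,b_1]\times\cdots\times[a_d,b_d]$ with $a_k<b_k$ for all $k$; the set of cuboids is topologized as the subspace $\{(a,b): a_k<b_k \text{ for all } k\}$ of $\mathbb{R}^d\times\mathbb{R}^d$. A cube is a cuboid all of whose edge lengths $b_k-a_k$ are equal. Spaces of $n$-tuples of cuboids carry the subspace topology of the $n$-fold product, and the symmetric group $S_n$ acts on all spaces of $n$-tuples by permuting the entries. Let $F(\mathbb{R}^d,n)=\{(x_1,\dots,x_n)\in(\mathbb{R}^d)^n : x_i\ne x_j \text{ for } i\ne j\}$. (1) The space of ordered $n$-tuples of pairwise disjoint axis-aligned cuboids in $\mathbb{R}^d$ is $S_n$-equivariantly homotopy equivalent to $F(\mathbb{R}^d,n)$. (2) The space of ordered $n$-tuples of pairwise disjoint axis-aligned cubes in $\mathbb{R}^d$ that all have the same edge length (the common length being allowed to vary from tuple to tuple) is $S_n$-equivariantly homotopy equivalent to $F(\mathbb{R}^d,n)$. Here two $S_n$-spaces $X,Y$ are $S_n$-equivariantly homotopy equivalent if there are $S_n$-equivariant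 continuous maps $f:X\to Y$ and $g:Y\to X$ such that $g\circ f$ and $f\circ g$ are homotopic to the identities through $S_n$-equivariant maps. -/

import Mathlib

/-- The ordered configuration space `F(X, n)`: `n`-tuples of pairwise distinct points of `X`,
with the subspace topology of `X ^ n`. -/
def OrderedConf (X : Type*) (n : ℕ) : Type _ :=
  {x : Fin n → X // Function.Injective x}

namespace OrderedConf

variable {X : Type*} {n : ℕ}

instance [TopologicalSpace X] : TopologicalSpace (OrderedConf X n) :=
  inferInstanceAs (TopologicalSpace {x : Fin n → X // Function.Injective x})

/-- `S_n` permutes the labels: `(σ • x) i = x (σ⁻¹ i)`. -/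
instance : MulAction (Equiv.Perm (Fin n)) (OrderedConf X n) where
  smul σ x := ⟨fun i => x.1 (σ⁻¹ i), x.2.comp (σ⁻¹).injective⟩
  one_smul _ := rfl
  mul_smul σ τ x := Subtype.ext (funext fun i => by
    change x.1 ((σ * τ)⁻¹ i) = x.1 (τ⁻¹ (σ⁻¹ i))
    rw [mul_inv_rev, Equiv.Perm.mul_apply])

end OrderedConf

/-- The space of nontrivial axis-aligned cuboids `[a₁, b₁] × ⋯ × [a_d, b_d]` in `ℝ^d`, each given
by its vertex `a` with smallest and its vertex `b` with largest coordinates, where `a_k < b_k` for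
every `k`; it is topologized as a subspace of `ℝ^d × ℝ^d`. -/
abbrev Cuboid (d : ℕ) : Type :=
  {p : (Fin d → ℝ) × (Fin d → ℝ) // ∀ k, p.1 k < p.2 k}

namespace Cuboid

variable {d : ℕ}

/-- The cuboid as a (closed) subset of `ℝ^d`. -/
def toSet (C : Cuboid d) : Set (Fin d → ℝ) :=
  {x | ∀ k, C.1.1 k ≤ x k ∧ x k ≤ C.1.2 k}

/-- The cuboid is a cube all of whose edges have length `l`. -/
def IsCubeOfEdge (C : Cuboid d) (l : ℝ) : Prop :=
  ∀ k, C.1.2 k - C.1.1 k = l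

end Cuboid

/-- The space of ordered `n`-tuples of pairwise disjoint axis-aligned cuboids in `ℝ^d`, with the
subspace topology of the `n`-th power of the space of cuboids. -/
def CuboidConf (d n : ℕ) : Type :=
  {C : Fin n → Cuboid d // Pairwise fun i j => Disjoint (C i).toSet (C j).toSet}

namespace CuboidConf

variable {d n : ℕ}

instance : TopologicalSpace (CuboidConf d n) :=
  inferInstanceAs (TopologicalSpace
    {C : Fin n → Cuboid d // Pairwise fun i j => Disjoint (C i).toSet (C j).toSet})

/-- `S_n` permutes the labels: `(σ • C) i = C (σ⁻¹ i)`. -/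
instance : MulAction (Equiv.Perm (Fin n)) (CuboidConf d n) where
  smul σ C := ⟨fun i => C.1 (σ⁻¹ i), fun _ _ h => C.2 ((σ⁻¹).injective.ne h)⟩
  one_smul _ := rfl
  mul_smul σ τ C := Subtype.ext (funext fun i => by
    change C.1 ((σ * τ)⁻¹ i) = C.1 (τ⁻¹ (σ⁻¹ i))
    rw [mul_inv_rev, Equiv.Perm.mul_apply])

end CuboidConf

/-- The space of ordered `n`-tuples of pairwise disjoint axis-aligned cubes in `ℝ^d` that all have
the same edge length (which may vary from tuple to tuple), with the subspace topology. -/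
def EqualCubeConf (d n : ℕ) : Type :=
  {C : Fin n → Cuboid d // (Pairwise fun i j => Disjoint (C i).toSet (C j).toSet) ∧
    ∃ l : ℝ, 0 < l ∧ ∀ i, (C i).IsCubeOfEdge l}

namespace EqualCubeConf

variable {d n : ℕ}

instance : TopologicalSpace (EqualCubeConf d n) :=
  inferInstanceAs (TopologicalSpace
    {C : Fin n → Cuboid d // (Pairwise fun i j => Disjoint (C i).toSet (C j).toSet) ∧
      ∃ l : ℝ, 0 < l ∧ ∀ i, (C i).IsCubeOfEdge l})

/-- `S_n` permutes the labels: `(σ • C) i = C (σ⁻¹ i)`. -/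
instance : MulAction (Equiv.Perm (Fin n)) (EqualCubeConf d n) where
  smul σ C := ⟨fun i => C.1 (σ⁻¹ i), fun _ _ h => C.2.1 ((σ⁻¹).injective.ne h),
    C.2.2.imp fun _ hl => ⟨hl.1, fun i => hl.2 (σ⁻¹ i)⟩⟩
  one_smul _ := rfl
  mul_smul σ τ C := Subtype.ext (funext fun i => by
    change C.1 ((σ * τ)⁻¹ i) = C.1 (τ⁻¹ (σ⁻¹ i))
    rw [mul_inv_rev, Equiv.Perm.mul_apply])

end EqualCubeConf

/-- `X` and `Y` are `G`-equivariantly homotopy equivalent: there are equivariant continuous maps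
`f : X → Y` and `g : Y → X` together with homotopies from `g ∘ f` and `f ∘ g` to the identities
that are equivariant at every time. -/
def EquivariantHomotopyEquivalent (G X Y : Type*) [Group G] [TopologicalSpace X]
    [TopologicalSpace Y] [MulAction G X] [MulAction G Y] : Prop :=
  ∃ (f : C(X, Y)) (g : C(Y, X)),
    (∀ (σ : G) (x : X), f (σ • x) = σ • f x) ∧
    (∀ (σ : G) (y : Y), g (σ • y) = σ • g y) ∧
    (∃ H : (g.comp f).Homotopy (ContinuousMap.id X),
      ∀ (t : unitInterval) (σ : G) (x : X), H (t, σ • x) = σ • H (t, x)) ∧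
    (∃ K : (f.comp g).Homotopy (ContinuousMap.id Y),
      ∀ (t : unitInterval) (σ : G) (y : Y), K (t, σ • y) = σ • K (t, y))

/-!
Both equivalences send a tuple of cuboids to the tuple of its midpoints. In the other direction a
configuration of points is sent to the cubes with these midpoints and half edge length a quarter of
the minimal distance in the supremum norm (`quarterSep`); such cubes are disjoint
(`separated_of_le_quarterSep`). Going from points to cubes and back is the identity, so everything
rests on deforming a tuple of disjoint cuboids to the associated cubes with the midpoints fixed.

A direct linear interpolation of the half edge lengths `w` to their target `s` may create overlaps,
because two cuboids may be separated in one coordinate direction and the corresponding cubes in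
another one. Passing through `min w s` avoids this (`twoStage`): between `w` and `min w s` every
cuboid is contained in the original one, and between `min w s` and `s` all half edge lengths are at
most `s`, so that the cuboids are disjoint by the choice of `s`.

The new half edge lengths are obtained from the old ones by one and the same function, hence the
deformation also preserves tuples of cubes with a common edge length. The argument is therefore
carried out once (`equivariantHomotopyEquivalent_of_isEmbedding`), for every space of tuples of
disjoint cuboids that is closed under such changes and contains the tuples of equal cubes.
-/

open Set Topology

/-! ### Boxes in terms of midpoints and half edge lengths -/

/-- The midpoint of the box with extreme vertices `p.1` and `p.2`. -/
noncomputable def boxCenter {d : ℕ} (p : (Fin d → ℝ) × (Fin d → ℝ)) : Fin d → ℝ :=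
  fun k => (p.1 k + p.2 k) / 2

/-- The half edge lengths of the box with extreme vertices `p.1` and `p.2`. -/
noncomputable def boxRadius {d : ℕ} (p : (Fin d → ℝ) × (Fin d → ℝ)) : Fin d → ℝ :=
  fun k => (p.2 k - p.1 k) / 2

/-- The extreme vertices of the box with midpoint `c` and half edge lengths `w`. -/
def boxOf {d : ℕ} (c w : Fin d → ℝ) : (Fin d → ℝ) × (Fin d → ℝ) :=
  (fun k => c k - w k, fun k => c k + w k)

@[simp]
lemma boxCenter_boxOf {d : ℕ} (c w : Fin d → ℝ) : boxCenter (boxOf c w) = c := by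
  funext k
  simp [boxCenter, boxOf]

@[simp]
lemma boxRadius_boxOf {d : ℕ} (c w : Fin d → ℝ) : boxRadius (boxOf c w) = w := by
  funext k
  simp only [boxRadius, boxOf]
  ring

@[simp]
lemma boxOf_boxCenter_boxRadius {d : ℕ} (p : (Fin d → ℝ) × (Fin d → ℝ)) :
    boxOf (boxCenter p) (boxRadius p) = p := by
  refine Prod.ext (funext fun k => ?_) (funext fun k => ?_) <;>
    simp only [boxCenter, boxRadius, boxOf] <;> ring

lemma continuous_boxCenter {d : ℕ} :
    Continuous (boxCenter : (Fin d → ℝ) × (Fin d → ℝ) → Fin d → ℝ) := by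
  unfold boxCenter
  fun_prop

lemma continuous_boxRadius {d : ℕ} :
    Continuous (boxRadius : (Fin d → ℝ) × (Fin d → ℝ) → Fin d → ℝ) := by
  unfold boxRadius
  fun_prop

lemma Continuous.boxOf {X : Type*} [TopologicalSpace X] {d n : ℕ} {c w : X → Fin n → Fin d → ℝ}
    (hc : Continuous c) (hw : Continuous w) : Continuous fun x i => boxOf (c x i) (w x i) := by
  unfold _root_.boxOf
  fun_prop

/-- For each pair of distinct indices, some coordinate direction strictly separates the boxes with
midpoints `c i` and half edge lengths `w i`. -/
def Separated {d n : ℕ} (c w : Fin n → Fin d → ℝ) : Prop :=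
  Pairwise fun i j => ∃ k, w i k + w j k < |c i k - c j k|

lemma Separated.mono {d n : ℕ} {c w w' : Fin n → Fin d → ℝ} (h : Separated c w)
    (hw : ∀ i k, w' i k ≤ w i k) : Separated c w' := fun i j hij => by
  obtain ⟨k, hk⟩ := h hij
  exact ⟨k, (add_le_add (hw i k) (hw j k)).trans_lt hk⟩

lemma Separated.injective {d n : ℕ} {c w : Fin n → Fin d → ℝ} (h : Separated c w)
    (hw : ∀ i k, 0 < w i k) : Function.Injective c := fun i j hc => by
  by_contra hij
  obtain ⟨k, hk⟩ := h hij
  rw [hc, sub_self, abs_zero] at hk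
  linarith [hw i k, hw j k]

lemma Cuboid.disjoint_toSet_iff {d : ℕ} (C D : Cuboid d) :
    Disjoint C.toSet D.toSet ↔
      ∃ k, boxRadius C.1 k + boxRadius D.1 k < |boxCenter C.1 k - boxCenter D.1 k| := by
  constructor
  · intro h
    by_contra! hk
    have hle (k : Fin d) : C.1.1 k ≤ D.1.2 k ∧ D.1.1 k ≤ C.1.2 k := by
      have h1 := abs_le.1 (hk k)
      simp only [boxRadius, boxCenter] at h1
      constructor <;> linarith
    -- The coordinatewise maximum of the two lower vertices is a common point.
    exact Set.disjoint_left.1 h (show (fun k => max (C.1.1 k) (D.1.1 k)) ∈ C.toSet from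
      fun k => ⟨le_max_left _ _, max_le (C.2 k).le (hle k).2⟩)
      (fun k => ⟨le_max_right _ _, max_le (hle k).1 (D.2 k).le⟩)
  · rintro ⟨k, hk⟩
    refine Set.disjoint_left.2 fun x hx hy => ?_
    have hC := hx k
    have hD := hy k
    simp only [boxRadius, boxCenter] at hk
    rcases lt_abs.1 hk with h | h <;> linarith

lemma pairwise_disjoint_toSet_iff {d n : ℕ} (C : Fin n → Cuboid d) :
    (Pairwise fun i j => Disjoint (C i).toSet (C j).toSet) ↔
      Separated (fun i => boxCenter (C i).1) (fun i => boxRadius (C i).1) := by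
  simp only [Separated, Cuboid.disjoint_toSet_iff]

/-! ### The minimal distance of a configuration -/

lemma offDiag_univ_nonempty (n : ℕ) [Nontrivial (Fin n)] :
    (Finset.univ : Finset (Fin n)).offDiag.Nonempty := by
  obtain ⟨i, j, hij⟩ := exists_pair_ne (Fin n)
  exact ⟨(i, j), by simpa using hij⟩

/-- A quarter of the minimal distance (in the supremum norm) between two points with distinct
labels. -/
noncomputable def quarterSep {d n : ℕ} [Nontrivial (Fin n)] (c : Fin n → Fin d → ℝ) : ℝ :=
  (Finset.univ.offDiag.inf' (offDiag_univ_nonempty n)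
    fun p : Fin n × Fin n => dist (c p.1) (c p.2)) / 4

section QuarterSep

variable {d n : ℕ} [Nontrivial (Fin n)]

lemma continuous_quarterSep : Continuous (quarterSep : (Fin n → Fin d → ℝ) → ℝ) := by
  unfold quarterSep
  refine Continuous.div_const (Continuous.finset_inf'_apply _ fun p _ => ?_) _
  fun_prop

lemma quarterSep_pos {c : Fin n → Fin d → ℝ} (hc : Function.Injective c) : 0 < quarterSep c := by
  refine div_pos ((Finset.lt_inf'_iff _).2 fun p hp => ?_) (by norm_num)
  exact dist_pos.2 (hc.ne (Finset.mem_offDiag.1 hp).2.2)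

lemma quarterSep_le (c : Fin n → Fin d → ℝ) {i j : Fin n} (hij : i ≠ j) :
    4 * quarterSep c ≤ dist (c i) (c j) := by
  have h := Finset.inf'_le (fun p : Fin n × Fin n => dist (c p.1) (c p.2))
    (show (i, j) ∈ Finset.univ.offDiag by simpa using hij)
  unfold quarterSep
  linarith

lemma quarterSep_comp_perm (c : Fin n → Fin d → ℝ) (σ : Equiv.Perm (Fin n)) :
    quarterSep (fun i => c (σ i)) = quarterSep c := by
  have key (c : Fin n → Fin d → ℝ) (σ : Equiv.Perm (Fin n)) :
      quarterSep c ≤ quarterSep (fun i => c (σ i)) := by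
    have h : 4 * quarterSep c ≤ 4 * quarterSep (fun i => c (σ i)) := by
      conv_rhs => rw [quarterSep, mul_div_cancel₀ _ (by norm_num)]
      exact Finset.le_inf' _ _ fun p hp =>
        quarterSep_le c (σ.injective.ne (Finset.mem_offDiag.1 hp).2.2)
    linarith
  refine le_antisymm ?_ (key c σ)
  simpa using key (fun i => c (σ i)) σ⁻¹

lemma separated_of_le_quarterSep {c w : Fin n → Fin d → ℝ} (hc : Function.Injective c)
    (hw : ∀ i k, w i k ≤ quarterSep c) : Separated c w := fun i j hij => by
  by_contra! h
  have hpos := quarterSep_pos hc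
  have h1 : dist (c i) (c j) ≤ 2 * quarterSep c :=
    (dist_pi_le_iff (by positivity)).2 fun k => by
      rw [Real.dist_eq]
      linarith [h k, hw i k, hw j k]
  linarith [quarterSep_le c hij]

end QuarterSep

/-! ### The two-stage path of half edge lengths -/

/-- The path from `s` (at `t = 0`) to `r` (at `t = 1`) that runs linearly through `min r s` at
`t = 1 / 2`. -/
noncomputable def twoStage (s t r : ℝ) : ℝ :=
  min r s + max (1 - 2 * t) 0 * (s - min r s) + max (2 * t - 1) 0 * (r - min r s)

lemma Continuous.twoStage {X : Type*} [TopologicalSpace X] {s t r : X → ℝ} (hs : Continuous s)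
    (ht : Continuous t) (hr : Continuous r) : Continuous fun x => twoStage (s x) (t x) (r x) := by
  unfold _root_.twoStage
  fun_prop

@[simp]
lemma twoStage_zero (s r : ℝ) : twoStage s 0 r = s := by
  norm_num [twoStage]

@[simp]
lemma twoStage_one (s r : ℝ) : twoStage s 1 r = r := by
  norm_num [twoStage]

lemma twoStage_pos {s r : ℝ} (hs : 0 < s) (hr : 0 < r) (t : ℝ) : 0 < twoStage s t r := by
  have h1 : 0 < min r s := lt_min hr hs
  have h2 : 0 ≤ s - min r s := sub_nonneg.2 (min_le_right _ _)
  have h3 : 0 ≤ r - min r s := sub_nonneg.2 (min_le_left _ _)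
  unfold twoStage
  positivity

lemma twoStage_le_left {s t : ℝ} (r : ℝ) (h0 : 0 ≤ t) (h : t ≤ 1 / 2) : twoStage s t r ≤ s := by
  have h2 : 0 ≤ s - min r s := sub_nonneg.2 (min_le_right _ _)
  rw [twoStage, max_eq_left (by linarith), max_eq_right (by linarith)]
  nlinarith [mul_nonneg h0 h2]

lemma twoStage_le_right {s t : ℝ} (r : ℝ) (h : 1 / 2 ≤ t) (h1 : t ≤ 1) : twoStage s t r ≤ r := by
  have h2 : 0 ≤ r - min r s := sub_nonneg.2 (min_le_left _ _)
  rw [twoStage, max_eq_right (by linarith), max_eq_left (by linarith)]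
  nlinarith [mul_nonneg (sub_nonneg.2 h1) h2]

lemma Separated.twoStage {d n : ℕ} [Nontrivial (Fin n)] {c w : Fin n → Fin d → ℝ}
    (h : Separated c w) (hc : Function.Injective c) (t : unitInterval) :
    Separated c (fun i k => twoStage (quarterSep c) t (w i k)) := by
  rcases le_total (t : ℝ) (1 / 2) with ht | ht
  · exact separated_of_le_quarterSep hc fun i k => twoStage_le_left _ t.2.1 ht
  · exact h.mono fun i k => twoStage_le_right _ ht t.2.2

/-! ### Spaces of tuples of disjoint boxes -/

/-- The homotopy equivalence for a space `Y` of tuples of disjoint boxes, embedded by `ι` into the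
space of tuples of pairs of extreme vertices. It is assumed that `Y` contains all tuples of disjoint
cubes with a common edge length, and that a tuple in `Y` stays in `Y` when a function `φ` is
applied to all its half edge lengths, as long as the resulting boxes are nontrivial and disjoint. -/
theorem equivariantHomotopyEquivalent_of_isEmbedding {d n : ℕ} [Nontrivial (Fin n)]
    {Y : Type*} [TopologicalSpace Y] [MulAction (Equiv.Perm (Fin n)) Y]
    (ι : Y → Fin n → (Fin d → ℝ) × (Fin d → ℝ)) (hι : IsEmbedding ι)
    (hsmul : ∀ (σ : Equiv.Perm (Fin n)) y i, ι (σ • y) i = ι y (σ⁻¹ i))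
    (hpos : ∀ y i k, 0 < boxRadius (ι y i) k)
    (hsep : ∀ y, Separated (fun i => boxCenter (ι y i)) (fun i => boxRadius (ι y i)))
    (hcube : ∀ (c : Fin n → Fin d → ℝ) (r : ℝ), 0 < r → Separated c (fun _ _ => r) →
      ∃ y, ι y = fun i => boxOf (c i) (fun _ => r))
    (hmap : ∀ (y : Y) (φ : ℝ → ℝ), (∀ r, 0 < r → 0 < φ r) →
      Separated (fun i => boxCenter (ι y i)) (fun i k => φ (boxRadius (ι y i) k)) →
      ∃ y', ι y' = fun i => boxOf (boxCenter (ι y i)) (fun k => φ (boxRadius (ι y i) k))) :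
    EquivariantHomotopyEquivalent (Equiv.Perm (Fin n)) Y (OrderedConf (Fin d → ℝ) n) := by
  let c (y : Y) : Fin n → Fin d → ℝ := fun i => boxCenter (ι y i)
  have hc (y : Y) : Function.Injective (c y) := (hsep y).injective (hpos y)
  have hc_cont : Continuous c :=
    continuous_pi fun i => continuous_boxCenter.comp ((continuous_apply i).comp hι.continuous)
  have hc_smul (σ : Equiv.Perm (Fin n)) (y : Y) : c (σ • y) = fun i => c y (σ⁻¹ i) := by
    funext i
    simp only [c, hsmul]
  let f (y : Y) : OrderedConf (Fin d → ℝ) n := ⟨c y, hc y⟩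
  choose g hg using fun x : OrderedConf (Fin d → ℝ) n =>
    hcube x.1 (quarterSep x.1) (quarterSep_pos x.2)
      (separated_of_le_quarterSep x.2 fun _ _ => le_rfl)
  choose H hH using fun (t : unitInterval) (y : Y) =>
    hmap y (twoStage (quarterSep (c y)) t) (fun r hr => twoStage_pos (quarterSep_pos (hc y)) hr t)
      ((hsep y).twoStage (hc y) t)
  have hg_cont : Continuous g := by
    rw [hι.isInducing.continuous_iff, show ι ∘ g = _ from funext hg]
    have h : Continuous fun x : OrderedConf (Fin d → ℝ) n => x.1 := continuous_subtype_val
    exact h.boxOf <| continuous_pi fun _ => continuous_pi fun _ => continuous_quarterSep.comp h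
  have hH_cont : Continuous fun p : unitInterval × Y => H p.1 p.2 := by
    rw [hι.isInducing.continuous_iff,
      show ι ∘ (fun p : unitInterval × Y => H p.1 p.2) = _ from funext fun p => hH p.1 p.2]
    have h : Continuous fun p : unitInterval × Y => ι p.2 := hι.continuous.comp continuous_snd
    refine (hc_cont.comp continuous_snd).boxOf <| continuous_pi fun i => continuous_pi fun k =>
      (continuous_quarterSep.comp (hc_cont.comp continuous_snd)).twoStage
        (continuous_subtype_val.comp continuous_fst) ?_
    exact (continuous_apply k).comp (continuous_boxRadius.comp ((continuous_apply i).comp h))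
  refine ⟨⟨f, hc_cont.subtype_mk _⟩, ⟨g, hg_cont⟩, fun σ y => ?_, fun σ x => ?_,
    ⟨{ toFun := fun p => H p.1 p.2
       continuous_toFun := hH_cont
       map_zero_left := fun y => hι.injective ?_
       map_one_left := fun y => hι.injective ?_ }, fun t σ y => hι.injective ?_⟩, ?_⟩
  · exact Subtype.ext (hc_smul σ y)
  · refine hι.injective (funext fun i => ?_)
    have h : quarterSep (σ • x).1 = quarterSep x.1 := quarterSep_comp_perm x.1 σ⁻¹
    change ι (g (σ • x)) i = ι (σ • g x) i
    rw [hsmul, hg, hg, h]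
    rfl
  · change ι (H 0 y) = ι (g (f y))
    rw [hH, hg]
    simp only [Set.Icc.coe_zero, twoStage_zero, c, f]
  · change ι (H 1 y) = ι y
    rw [hH]
    simp
  · change ι (H t (σ • y)) = ι (σ • H t y)
    funext i
    rw [hsmul, hH, hH, hc_smul, quarterSep_comp_perm]
    simp only [hsmul]
  · refine ⟨(ContinuousMap.Homotopy.refl _).cast ?_ rfl, fun t σ x => rfl⟩
    ext1 x
    refine Subtype.ext ?_
    change x.1 = c (g x)
    simp only [c, hg, boxCenter_boxOf]

/-! ### Cuboids and cubes with a common edge length -/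

lemma isEmbedding_vertices (d n : ℕ) :
    IsEmbedding fun (C : Fin n → Cuboid d) i => (C i).1 :=
  IsEmbedding.piMap fun _ => IsEmbedding.subtypeVal

lemma Cuboid.boxRadius_pos {d : ℕ} (C : Cuboid d) (k : Fin d) : 0 < boxRadius C.1 k :=
  half_pos (sub_pos.2 (C.2 k))

/-- The cuboid with midpoint `c` and half edge lengths `w`. -/
def Cuboid.ofCenter {d : ℕ} (c w : Fin d → ℝ) (hw : ∀ k, 0 < w k) : Cuboid d :=
  ⟨boxOf c w, fun k => by simp only [boxOf]; linarith [hw k]⟩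

lemma pairwise_disjoint_ofCenter {d n : ℕ} {c w : Fin n → Fin d → ℝ} (hw : ∀ i k, 0 < w i k)
    (h : Separated c w) : Pairwise fun i j =>
      Disjoint (Cuboid.ofCenter (c i) (w i) (hw i)).toSet
        (Cuboid.ofCenter (c j) (w j) (hw j)).toSet :=
  (pairwise_disjoint_toSet_iff fun i => Cuboid.ofCenter (c i) (w i) (hw i)).2 <| by
    simpa [Cuboid.ofCenter] using h

lemma Cuboid.isCubeOfEdge_ofCenter {d : ℕ} (c w : Fin d → ℝ) (hw : ∀ k, 0 < w k) {r : ℝ}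
    (h : ∀ k, w k = r) : (Cuboid.ofCenter c w hw).IsCubeOfEdge (2 * r) := fun k => by
  simp only [Cuboid.ofCenter, boxOf, h k]
  ring

theorem cuboidConf_equivariantHomotopyEquivalent (d n : ℕ) [Nontrivial (Fin n)] :
    EquivariantHomotopyEquivalent (Equiv.Perm (Fin n))
      (CuboidConf d n) (OrderedConf (Fin d → ℝ) n) :=
  equivariantHomotopyEquivalent_of_isEmbedding (fun C i => (C.1 i).1)
    ((isEmbedding_vertices d n).comp IsEmbedding.subtypeVal)
    (fun _ _ _ => rfl)
    (fun C i => (C.1 i).boxRadius_pos)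
    (fun C => (pairwise_disjoint_toSet_iff C.1).1 C.2)
    (fun _ _ hr h => ⟨⟨_, pairwise_disjoint_ofCenter (fun _ _ => hr) h⟩, rfl⟩)
    (fun C _ hφ h =>
      ⟨⟨_, pairwise_disjoint_ofCenter (fun i k => hφ _ ((C.1 i).boxRadius_pos k)) h⟩, rfl⟩)

theorem equalCubeConf_equivariantHomotopyEquivalent (d n : ℕ) [Nontrivial (Fin n)] :
    EquivariantHomotopyEquivalent (Equiv.Perm (Fin n))
      (EqualCubeConf d n) (OrderedConf (Fin d → ℝ) n) := by
  refine equivariantHomotopyEquivalent_of_isEmbedding (fun C i => (C.1 i).1)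
    ((isEmbedding_vertices d n).comp IsEmbedding.subtypeVal)
    (fun _ _ _ => rfl)
    (fun C i => (C.1 i).boxRadius_pos)
    (fun C => (pairwise_disjoint_toSet_iff C.1).1 C.2.1)
    (fun c r hr h => ⟨⟨_, pairwise_disjoint_ofCenter (fun _ _ => hr) h, 2 * r, by positivity,
      fun i => Cuboid.isCubeOfEdge_ofCenter _ _ _ fun _ => rfl⟩, rfl⟩)
    (fun C φ hφ h => ?_)
  -- All half edge lengths equal `l / 2`, so `φ` turns them into the common value `φ (l / 2)`.
  obtain ⟨l, hl, hC⟩ := C.2.2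
  refine ⟨⟨_, pairwise_disjoint_ofCenter (fun i k => hφ _ ((C.1 i).boxRadius_pos k)) h,
    2 * φ (l / 2), mul_pos two_pos (hφ _ (half_pos hl)),
    fun i => Cuboid.isCubeOfEdge_ofCenter _ _ _ fun k => ?_⟩, rfl⟩
  simp only [boxRadius, hC i k]

theorem mainTheorem8 (d n : ℕ) (hn : 2 ≤ n) :
    EquivariantHomotopyEquivalent (Equiv.Perm (Fin n))
      (CuboidConf d n) (OrderedConf (Fin d → ℝ) n) ∧
    EquivariantHomotopyEquivalent (Equiv.Perm (Fin n))
      (EqualCubeConf d n) (OrderedConf (Fin d → ℝ) n) := by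
  have : Nontrivial (Fin n) := Fin.nontrivial_iff_two_le.2 hn
  exact ⟨cuboidConf_equivariantHomotopyEquivalent d n,
    equalCubeConf_equivariantHomotopyEquivalent d n⟩
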